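/- Let $d\ge 0$, let $S=\mathbb{Z}[x_0,\dots,x_d]$, let $f\in S$ be a nonzero homogeneous polynomial, and set $R=S/(f)$. Let $P_R=R\otimes_{\mathbb{Z}}R$, identified with $\mathbb{Z}[\boldsymbol{x},\boldsymbol{y}]/(f(\boldsymbol{x}),f(\boldsymbol{y}))$ via $x_i\otimes 1\leftrightarrow x_i$ and $1\otimes x_i\leftrightarrow y_i$, where $\boldsymbol{y}=y_0,\dots,y_d$, and let $\Delta_R$ be the kernel of the multiplication map $P_R\to R$; it is generated by $y_0-x_0,\dots,y_d-x_d$. Let $p>0$ be a prime integer that is a nonzerodivisor on $P_R$. Let $\Lambda_p$ be the ring endomorphism of $\mathbb{Z}[\boldsymbol{x},\boldsymbol{y}]$ with $\Lambda_p(x_i)=x_i^p$ and $\Lambda_p(y_i-x_i)=(y_i-x_i)^p$ for each $i$, and let $\varphi_p(s)=\frac{1}{p}\big(\Lambda_p(s)-s^p\big)$ be the corresponding $p$-derivation. The Frobenius trace $\Phi_{R/pR}\colon R/pR\to R/pR$ is the additive map that sends the class of $s\in\mathbb{F}_p[\boldsymbol{x}]$ to the class of $\partial_{p-1,\dots,p-1}(f^{p-1}s)$;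 here $R/pR=\mathbb{F}_p[\boldsymbol{x}]/(f)$, and $\partial_{p-1,\dots,p-1}$ is the $\mathbb{F}_p$-linear map with $x_0^{b_0}\cdots x_d^{b_d}\mapsto\prod_i\binom{b_i}{p-1}x_i^{b_i-(p-1)}$ (read as $0$ if some $b_i<p-1$). A differential operator on a commutative ring $T$ is an additive map $T\to T$ that has order at most $n$ for some $n\ge 0$, where the operators of order at most $0$ are the multiplications by elements of $T$, and $\delta$ has order at most $n+1$ if its commutator with multiplication by each element of $T$ has order at most $n$. For $T=R$ or $T=R/p^2R$, with canonical surjection $\pi\colon T\to R/pR$, the map $\Phi_{R/pR}$ lifts to a differential operator on $T$ if there is a differential operator $\delta$ on $T$ with $\pi\circ\delta=\Phi_{R/pR}\circ\pi$. For a $P_R$-module $M$, the local cohomology module $H^{d+1}_{\Delta_R}(M)$ is $M_{z_0\cdots z_d}\big/\sum_i M_{z_0\cdots\hat{z}_i\cdots z_d}$, where $z_i=y_i-x_i$. Then: 1. $\Phi_{R/pR}$ lifts to a differential operator on $R$ if and only if the element $$\left[\frac{\varphi_p\big(f(\boldsymbol{y})-f(\boldsymbol{x})\big)}{\prod_{i=0}^d(y_i-x_i)^p}\right]\in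 H^{d+1}_{\Delta_R}(P_R)$$ is zero. 2. $\Phi_{R/pR}$ lifts to a differential operator on $R/p^2R$ if and only if the image of this element in $H^{d+1}_{\Delta_R}(P_R/pP_R)$ is zero. -/

import Mathlib

open scoped TensorProduct

noncomputable section

namespace FrobTrace

/-! ### Differential operators -/

/-- The additive maps `R → R`. -/
abbrev AddEnd (R : Type*) [CommRing R] : Type _ := R →+ R

section DiffOp

variable {R : Type*} [CommRing R]

/-- `IsDiffOpOfOrderLE n δ`: the additive map `δ : R → R` is a differential operator of order at
most `n`. Order zero means multiplication by an element of `R`; order at most `n + 1` means that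
every commutator `[r, δ]` is a differential operator of order at most `n`. -/
def IsDiffOpOfOrderLE : ℕ → AddEnd R → Prop
  | 0, δ => ∃ r : R, δ = AddMonoidHom.mulLeft r
  | n + 1, δ => ∀ r : R, IsDiffOpOfOrderLE n
      ((AddMonoidHom.mulLeft r).comp δ - AddMonoidHom.comp δ (AddMonoidHom.mulLeft r))

/-- Membership in the ring `D_R` of differential operators on `R`. -/
def IsDiffOp (δ : AddEnd R) : Prop := ∃ n : ℕ, IsDiffOpOfOrderLE n δ

/-- Given a (surjective) ring homomorphism `π : R → R'`, an additive endomorphism `δ'` of `R'`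
lifts to a differential operator on `R` if some `δ ∈ D_R` satisfies `π ∘ δ = δ' ∘ π`. -/
def LiftsToDiffOp {R' : Type*} [CommRing R'] (π : R →+* R') (δ' : AddEnd R') : Prop :=
  ∃ δ : AddEnd R, IsDiffOp δ ∧ ∀ r : R, π (δ r) = δ' (π r)

end DiffOp

/-! ### Top local cohomology, by the Čech complex -/

section Cech

variable {A : Type*} [CommRing A] {ι : Type*} [Fintype ι] [DecidableEq ι]

/-- The multiplicative set of the powers of `∏ z_j`. -/
abbrev fullPowers (z : ι → A) : Submonoid A := Submonoid.powers (∏ j, z j)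

/-- The multiplicative set of the powers of the product of the `z_j` with `j ≠ i`. -/
abbrev facePowers (z : ι → A) (i : ι) : Submonoid A :=
  Submonoid.powers (∏ j ∈ Finset.univ.erase i, z j)

theorem isUnit_facePowers (z : ι → A) (M : Type*) [AddCommGroup M] [Module A M] (i : ι)
    (s : facePowers z i) :
    IsUnit (algebraMap A (Module.End A (LocalizedModule (fullPowers z) M)) s) := by
  obtain ⟨_, n, rfl⟩ := s
  have h : IsUnit (algebraMap A (Module.End A (LocalizedModule (fullPowers z) M)) (∏ j, z j)) :=
    IsLocalizedModule.map_units (S := fullPowers z)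
      (LocalizedModule.mkLinearMap (fullPowers z) M) ⟨_, Submonoid.mem_powers _⟩
  rw [← Finset.mul_prod_erase Finset.univ z (Finset.mem_univ i), map_mul,
    Commute.isUnit_mul_iff (Algebra.commutes _ _)] at h
  simpa only [map_pow] using h.2.pow n

/-- The natural map `M_{z₀⋯ẑᵢ⋯z_t} → M_{z₀⋯z_t}`. -/
def cechFace (z : ι → A) (M : Type*) [AddCommGroup M] [Module A M] (i : ι) :
    LocalizedModule (facePowers z i) M →ₗ[A] LocalizedModule (fullPowers z) M :=
  LocalizedModule.lift (facePowers z i) (LocalizedModule.mkLinearMap (fullPowers z) M)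
    (isUnit_facePowers z M i)

/-- The image of the last differential of the Čech complex `C(z₀, …, z_t; M)`, which is
`∑ᵢ M_{z₀⋯ẑᵢ⋯z_t}` in `M_{z₀⋯z_t}`. -/
def cechBoundary (z : ι → A) (M : Type*) [AddCommGroup M] [Module A M] :
    Submodule A (LocalizedModule (fullPowers z) M) :=
  ⨆ i, LinearMap.range (cechFace z M i)

/-- For `z = (z₀, …, z_t)`, the local cohomology module
`H^{t+1}_{(z)}(M) = M_{z₀⋯z_t} / ∑ᵢ M_{z₀⋯ẑᵢ⋯z_t}`. -/
def TopLocalCohomology (z : ι → A) (M : Type*) [AddCommGroup M] [Module A M] : Type _ :=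
  LocalizedModule (fullPowers z) M ⧸ cechBoundary z M

instance (z : ι → A) (M : Type*) [AddCommGroup M] [Module A M] :
    AddCommGroup (TopLocalCohomology z M) :=
  inferInstanceAs (AddCommGroup (LocalizedModule (fullPowers z) M ⧸ cechBoundary z M))

instance (z : ι → A) (M : Type*) [AddCommGroup M] [Module A M] :
    Module A (TopLocalCohomology z M) :=
  inferInstanceAs (Module A (LocalizedModule (fullPowers z) M ⧸ cechBoundary z M))

/-- The class of `m / (z₀⋯z_t)^n`. -/
def cechClass (z : ι → A) {M : Type*} [AddCommGroup M] [Module A M] (m : M) (n : ℕ) :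
    TopLocalCohomology z M :=
  Submodule.Quotient.mk (LocalizedModule.mk m ⟨(∏ j, z j) ^ n, n, rfl⟩)

variable {M N : Type*} [AddCommGroup M] [Module A M] [AddCommGroup N] [Module A N]

theorem cechBoundary_le_comap (z : ι → A) (g : M →ₗ[A] N) :
    cechBoundary z M ≤
      (cechBoundary z N).comap
        (IsLocalizedModule.map (fullPowers z) (LocalizedModule.mkLinearMap (fullPowers z) M)
          (LocalizedModule.mkLinearMap (fullPowers z) N) g) := by
  refine iSup_le fun i => ?_
  rintro _ ⟨x, rfl⟩
  refine Submodule.mem_iSup_of_mem i ⟨IsLocalizedModule.map (facePowers z i)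
    (LocalizedModule.mkLinearMap (facePowers z i) M)
    (LocalizedModule.mkLinearMap (facePowers z i) N) g x, ?_⟩
  simp only [← LinearMap.comp_apply]
  congr 1
  refine IsLocalizedModule.ext (facePowers z i) (LocalizedModule.mkLinearMap (facePowers z i) M)
    (isUnit_facePowers z N i) ?_
  rw [LinearMap.comp_assoc, LinearMap.comp_assoc, IsLocalizedModule.map_comp, cechFace, cechFace,
    LocalizedModule.lift_comp, IsLocalizedModule.map_comp, ← LinearMap.comp_assoc,
    LocalizedModule.lift_comp]

/-- The map `H^{t+1}_{(z)}(M) → H^{t+1}_{(z)}(N)` induced by a linear map `g : M → N`. -/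
def TopLocalCohomology.map (z : ι → A) (g : M →ₗ[A] N) :
    TopLocalCohomology z M →ₗ[A] TopLocalCohomology z N :=
  Submodule.mapQ _ _
    (IsLocalizedModule.map (fullPowers z) (LocalizedModule.mkLinearMap (fullPowers z) M)
      (LocalizedModule.mkLinearMap (fullPowers z) N) g)
    (cechBoundary_le_comap z g)

end Cech

/-! ### Hypersurfaces and the Frobenius trace -/

section Trace

variable {σ : Type*} [Fintype σ]

/-- The hypersurface `A[x] / (f)`. -/
abbrev Hypersurface {A : Type*} [CommRing A] (f : MvPolynomial σ A) : Type _ :=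
  MvPolynomial σ A ⧸ Ideal.span {f}

/-- The divided power differential operator `∂_a` on `A[x]`: the `A`-linear map with
`∂_a (x^b) = ∏ᵢ (bᵢ choose aᵢ) x^(b - a)`. -/
def dividedPartial (A : Type*) [CommRing A] (a : σ →₀ ℕ) :
    MvPolynomial σ A →ₗ[A] MvPolynomial σ A :=
  (MvPolynomial.basisMonomials σ A).constr A fun b =>
    MvPolynomial.monomial (b - a) (∏ i, ((b i).choose (a i) : A))

theorem dividedPartial_monomial (A : Type*) [CommRing A] (a b : σ →₀ ℕ) (c : A) :
    dividedPartial A a (MvPolynomial.monomial b c) =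
      MvPolynomial.monomial (b - a) (c * ∏ i, ((b i).choose (a i) : A)) := by
  have h : (MvPolynomial.monomial b c : MvPolynomial σ A) =
      c • MvPolynomial.basisMonomials σ A b := by
    simp [MvPolynomial.smul_monomial]
  rw [h, map_smul, dividedPartial, Module.Basis.constr_basis, MvPolynomial.smul_monomial,
    smul_eq_mul]

variable (p : ℕ) [Fact p.Prime] {A : Type*} [CommRing A] [CharP A p]

/-- `Φ_S = ∂_{p-1,…,p-1}` on `S = A[x]`. -/
def polyTrace (σ : Type*) [Fintype σ] (A : Type*) [CommRing A] :
    MvPolynomial σ A →ₗ[A] MvPolynomial σ A :=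
  dividedPartial A (Finsupp.equivFunOnFinite.symm fun _ => p - 1)

theorem cast_choose_pred (b c : ℕ) :
    (((b + p * c).choose (p - 1) : ℕ) : A) = ((b.choose (p - 1) : ℕ) : A) := by
  have hp := (Fact.out : p.Prime).pos
  rw [CharP.natCast_eq_natCast A p]
  have h1 := Choose.choose_modEq_choose_mod_mul_choose_div_nat (n := b + p * c) (k := p - 1) (p := p)
  have h2 := Choose.choose_modEq_choose_mod_mul_choose_div_nat (n := b) (k := p - 1) (p := p)
  rw [Nat.div_eq_of_lt (Nat.sub_lt hp one_pos)] at h1 h2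
  simp only [Nat.choose_zero_right, Nat.add_mul_mod_self_left] at h1 h2
  exact h1.trans h2.symm

/-- `Φ_S` is linear over `p`-th powers. -/
theorem polyTrace_pow_mul (g s : MvPolynomial σ A) :
    polyTrace p σ A (g ^ p * s) = g ^ p * polyTrace p σ A s := by
  have key : ∀ (b c : σ →₀ ℕ) (u v : A),
      polyTrace p σ A (MvPolynomial.monomial b u ^ p * MvPolynomial.monomial c v) =
        MvPolynomial.monomial b u ^ p * polyTrace p σ A (MvPolynomial.monomial c v) := by
    intro b c u v
    have hch : (∏ i, (((p • b + c) i).choose (p - 1) : A)) = ∏ i, ((c i).choose (p - 1) : A) := by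
      refine Finset.prod_congr rfl fun i _ => ?_
      simpa [add_comm] using cast_choose_pred p (A := A) (c i) (b i)
    simp only [polyTrace, MvPolynomial.monomial_pow, MvPolynomial.monomial_mul,
      dividedPartial_monomial, Finsupp.equivFunOnFinite_symm_apply_apply, hch]
    by_cases hc : ∀ i, p - 1 ≤ c i
    · have hexp : p • b + c - Finsupp.equivFunOnFinite.symm (fun _ => p - 1) =
          p • b + (c - Finsupp.equivFunOnFinite.symm (fun _ => p - 1)) := by
        ext i
        have := hc i
        simp only [Finsupp.coe_tsub, Finsupp.coe_add, Finsupp.coe_smul, Pi.sub_apply,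
          Pi.add_apply, Pi.smul_apply, smul_eq_mul, Finsupp.equivFunOnFinite_symm_apply_apply]
        omega
      rw [hexp, mul_assoc]
    · push Not at hc
      obtain ⟨i, hi⟩ := hc
      have h0 : (∏ i, ((c i).choose (p - 1) : A)) = 0 :=
        Finset.prod_eq_zero (Finset.mem_univ i)
          (by rw [Nat.choose_eq_zero_of_lt hi, Nat.cast_zero])
      simp [h0]
  have : ExpChar (MvPolynomial σ A) p := by
    have : CharP (MvPolynomial σ A) p := inferInstance
    exact ExpChar.prime Fact.out
  induction g using MvPolynomial.induction_on' with
  | monomial b u =>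
    induction s using MvPolynomial.induction_on' with
    | monomial c v => exact key b c u v
    | add s t hs ht => rw [mul_add, map_add, map_add, hs, ht, mul_add]
  | add g h hg hh => rw [add_pow_expChar, add_mul, add_mul, map_add, hg, hh]

/-- The Frobenius trace on `R = A[x]/(f)`, where `A` has characteristic `p`: the map induced by
`S → S → S → R`, multiplication by `f^(p-1)`, then `Φ_S`, then the canonical surjection. -/
def frobeniusTrace (f : MvPolynomial σ A) : AddEnd (Hypersurface f) :=
  QuotientAddGroup.map _ _
    ((polyTrace p σ A).toAddMonoidHom.comp (AddMonoidHom.mulLeft (f ^ (p - 1)))) <| by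
    intro s hs
    obtain ⟨t, rfl⟩ := Ideal.mem_span_singleton.mp hs
    refine Ideal.mem_span_singleton.mpr ?_
    change f ∣ polyTrace p σ A (f ^ (p - 1) * (f * t))
    rw [← mul_assoc, ← pow_succ, Nat.sub_add_cancel (Fact.out : p.Prime).one_le,
      polyTrace_pow_mul]
    exact Dvd.dvd.mul_right (dvd_pow_self _ (Fact.out : p.Prime).ne_zero) _

theorem frobeniusTrace_mk (f s : MvPolynomial σ A) :
    frobeniusTrace p f (Ideal.Quotient.mk _ s) =
      Ideal.Quotient.mk _ (polyTrace p σ A (f ^ (p - 1) * s)) := rfl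

end Trace

/-! ### Reduction modulo `p` -/

section Reduction

variable {σ : Type*} (f : MvPolynomial σ ℤ)

/-- For `R = ℤ[x]/(f)` and an integer `m`, the ring `R/mR`. -/
abbrev ModInt (m : ℕ) : Type _ := Hypersurface f ⧸ Ideal.span {(m : Hypersurface f)}

/-- The canonical surjection `R → R/mR`. -/
abbrev toModInt (m : ℕ) : Hypersurface f →+* ModInt f m := Ideal.Quotient.mk _

/-- The canonical surjection `R/p²R → R/pR`. -/
def modSqToMod (p : ℕ) : ModInt f (p ^ 2) →+* ModInt f p :=
  Ideal.Quotient.factor <| by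
    rw [Ideal.span_singleton_le_span_singleton, Nat.cast_pow]
    exact dvd_pow_self _ two_ne_zero

/-- Reduction of coefficients `ℤ[x]/(f) → 𝔽_p[x]/(f)`. -/
def coeffReduction (p : ℕ) :
    Hypersurface f →+* Hypersurface (MvPolynomial.map (Int.castRingHom (ZMod p)) f) :=
  Ideal.quotientMap _ (MvPolynomial.map (Int.castRingHom (ZMod p))) <| by
    rw [Ideal.span_singleton_le_iff_mem, Ideal.mem_comap]
    exact Ideal.mem_span_singleton_self _

theorem coeffReduction_surjective (p : ℕ) : Function.Surjective (coeffReduction f p) :=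
  Ideal.quotientMap_surjective
    (MvPolynomial.map_surjective (Int.castRingHom (ZMod p)) ZMod.intCast_surjective)

theorem ker_coeffReduction (p : ℕ) :
    RingHom.ker (coeffReduction f p) = Ideal.span {(p : Hypersurface f)} := by
  apply le_antisymm
  · intro r hr
    obtain ⟨s, rfl⟩ := Ideal.Quotient.mk_surjective r
    rw [RingHom.mem_ker, coeffReduction, Ideal.quotientMap_mk, Ideal.Quotient.eq_zero_iff_mem,
      Ideal.mem_span_singleton] at hr
    obtain ⟨t, ht⟩ := hr
    obtain ⟨t, rfl⟩ := MvPolynomial.map_surjective (Int.castRingHom (ZMod p)) ZMod.intCast_surjective t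
    rw [← map_mul, ← sub_eq_zero, ← map_sub, ← MvPolynomial.C_dvd_iff_zmod] at ht
    obtain ⟨u, hu⟩ := ht
    rw [Ideal.mem_span_singleton]
    refine ⟨Ideal.Quotient.mk _ u, ?_⟩
    rw [sub_eq_iff_eq_add] at hu
    rw [hu, map_add, map_mul, map_mul]
    simp
  · rw [Ideal.span_singleton_le_iff_mem, RingHom.mem_ker, map_natCast]
    rw [← map_natCast (Ideal.Quotient.mk _), ← map_natCast MvPolynomial.C, ZMod.natCast_self]
    simp

/-- The canonical isomorphism `R/pR ≅ 𝔽_p[x]/(f)`. -/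
def modPEquiv (p : ℕ) :
    ModInt f p ≃+* Hypersurface (MvPolynomial.map (Int.castRingHom (ZMod p)) f) :=
  (Ideal.quotEquivOfEq (ker_coeffReduction f p).symm).trans
    (RingHom.quotientKerEquivOfSurjective (coeffReduction_surjective f p))

/-- The Frobenius trace `Φ_{R/pR}`, with `R/pR` identified with `𝔽_p[x]/(f)`. -/
def frobeniusTraceModP [Fintype σ] (p : ℕ) [Fact p.Prime] : AddEnd (ModInt f p) :=
  ((modPEquiv f p).symm : _ ≃+ _).toAddMonoidHom.comp
    ((frobeniusTrace p (MvPolynomial.map (Int.castRingHom (ZMod p)) f)).comp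
      ((modPEquiv f p : _ ≃+ _).toAddMonoidHom))

end Reduction

/-! ### The enveloping algebra and the standard `p`-derivation -/

section Enveloping

variable (σ : Type*)

/-- `P_S = ℤ[x, y]`, where `x_i` is `X (Sum.inl i)` and `y_i` is `X (Sum.inr i)`. -/
abbrev PS : Type _ := MvPolynomial (σ ⊕ σ) ℤ

variable {σ}

/-- `x_i` in `ℤ[x, y]`. -/
abbrev xVar (i : σ) : PS σ := MvPolynomial.X (Sum.inl i)

/-- `y_i` in `ℤ[x, y]`. -/
abbrev yVar (i : σ) : PS σ := MvPolynomial.X (Sum.inr i)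

/-- `f(y) - f(x)` in `ℤ[x, y]`. -/
def polyDiff (f : MvPolynomial σ ℤ) : PS σ :=
  MvPolynomial.rename Sum.inr f - MvPolynomial.rename Sum.inl f

/-- The ring endomorphism `Λ_p` of `ℤ[x, y]` with `Λ_p(x_i) = x_i ^ p` and
`Λ_p(y_i - x_i) = (y_i - x_i) ^ p`. -/
def frobLift (p : ℕ) : PS σ →ₐ[ℤ] PS σ :=
  MvPolynomial.aeval
    (Sum.elim (fun i => xVar i ^ p) (fun i => xVar i ^ p + (yVar i - xVar i) ^ p))

theorem frobLift_x (p : ℕ) (i : σ) : frobLift p (xVar i) = xVar i ^ p := by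
  simp [frobLift]

theorem frobLift_y_sub_x (p : ℕ) (i : σ) :
    frobLift p (yVar i - xVar i) = (yVar i - xVar i) ^ p := by
  simp [frobLift]

theorem exists_pDerivation (p : ℕ) [Fact p.Prime] (s : PS σ) :
    ∃ t : PS σ, frobLift p s - s ^ p = (p : PS σ) * t := by
  suffices h : (MvPolynomial.C (p : ℤ) : PS σ) ∣ frobLift p s - s ^ p by
    simpa [Dvd.dvd] using h
  rw [MvPolynomial.C_dvd_iff_zmod, map_sub, map_pow, sub_eq_zero]
  have key : (MvPolynomial.map (Int.castRingHom (ZMod p))).comp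
      (frobLift p : PS σ →ₐ[ℤ] PS σ).toRingHom =
      (frobenius (MvPolynomial (σ ⊕ σ) (ZMod p)) p).comp
        (MvPolynomial.map (Int.castRingHom (ZMod p))) := by
    refine MvPolynomial.ringHom_ext' (RingHom.ext_int _ _) ?_
    rintro (i | i)
    · simp [frobLift, frobenius_def]
    · simp [frobLift, frobenius_def, sub_pow_char]
  exact DFunLike.congr_fun key s

/-- The `p`-derivation `φ_p(s) = (Λ_p(s) - s ^ p) / p` on `ℤ[x, y]`; the quotient is unique since
`p` is a nonzerodivisor. -/
def pDerivation (p : ℕ) [Fact p.Prime] (s : PS σ) : PS σ :=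
  Classical.choose (exists_pDerivation p s)

theorem pDerivation_spec (p : ℕ) [Fact p.Prime] (s : PS σ) :
    frobLift p s - s ^ p = (p : PS σ) * pDerivation p s :=
  Classical.choose_spec (exists_pDerivation p s)

variable (f : MvPolynomial σ ℤ)

/-- The enveloping algebra `R ⊗_ℤ R` of a ring `R`. -/
abbrev Enveloping (R : Type*) [CommRing R] : Type _ := R ⊗[ℤ] R

/-- `P_R = R ⊗_ℤ R` for `R = ℤ[x]/(f)`. -/
abbrev PR : Type _ := Enveloping (Hypersurface f)

/-- The canonical surjection `P_S = ℤ[x, y] → P_R` with `x_i ↦ x_i ⊗ 1` and `y_i ↦ 1 ⊗ x_i`. -/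
def toPR : PS σ →ₐ[ℤ] PR f :=
  MvPolynomial.aeval
    (Sum.elim (fun i => (Ideal.Quotient.mk _ (MvPolynomial.X i) : Hypersurface f) ⊗ₜ[ℤ] 1)
      (fun i => 1 ⊗ₜ[ℤ] (Ideal.Quotient.mk _ (MvPolynomial.X i) : Hypersurface f)))

/-- The elements `y_i - x_i` of `P_R`. -/
def diagGen (i : σ) : PR f := toPR f (yVar i - xVar i)

theorem diagGen_eq (i : σ) :
    diagGen f i = (1 : Hypersurface f) ⊗ₜ[ℤ] (Ideal.Quotient.mk _ (MvPolynomial.X i)) -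
      (Ideal.Quotient.mk _ (MvPolynomial.X i)) ⊗ₜ[ℤ] (1 : Hypersurface f) := by
  simp [diagGen, toPR]

/-- The elements `y_i - x_i` generate the kernel `Δ_R` of the multiplication `R ⊗ R → R`. -/
theorem span_diagGen :
    Ideal.span (Set.range (diagGen f)) = KaehlerDifferential.ideal ℤ (Hypersurface f) := by
  apply le_antisymm
  · rw [Ideal.span_le]
    rintro _ ⟨i, rfl⟩
    rw [diagGen_eq]
    exact KaehlerDifferential.one_smul_sub_smul_one_mem_ideal ℤ _
  · rw [← KaehlerDifferential.span_range_eq_ideal, Ideal.span_le]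
    rintro _ ⟨r, rfl⟩
    obtain ⟨s, rfl⟩ := Ideal.Quotient.mk_surjective r
    change _ ∈ Ideal.span (Set.range (diagGen f))
    have hq : (Ideal.Quotient.mk (Ideal.span (Set.range (diagGen f)))).comp
          ((Algebra.TensorProduct.includeRight : _ →ₐ[ℤ] PR f).toRingHom.comp
            (Ideal.Quotient.mk (Ideal.span {f}))) =
        (Ideal.Quotient.mk (Ideal.span (Set.range (diagGen f)))).comp
          ((Algebra.TensorProduct.includeLeft : _ →ₐ[ℤ] PR f).toRingHom.comp
            (Ideal.Quotient.mk (Ideal.span {f}))) := by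
      refine MvPolynomial.ringHom_ext' (RingHom.ext_int _ _) fun i => ?_
      refine Ideal.Quotient.eq.mpr (Ideal.subset_span ⟨i, ?_⟩)
      rw [diagGen_eq]
      rfl
    exact Ideal.Quotient.eq.mp (DFunLike.congr_fun hq s)

/-- The local cohomology `H^{d+1}_{Δ_R}(M)` of a `P_R`-module `M`, where `d + 1` is the number
of variables, computed on the generators `y_i - x_i` of `Δ_R`. -/
abbrev LocalCohomologyDelta [Fintype σ] [DecidableEq σ] (M : Type*) [AddCommGroup M]
    [Module (PR f) M] : Type _ :=
  TopLocalCohomology (diagGen f) M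

/-- The element `[φ_p(f(y) - f(x)) / ∏ (y_i - x_i)^p]` of `H^{d+1}_{Δ_R}(P_R)`. -/
def obstruction [Fintype σ] [DecidableEq σ] (p : ℕ) [Fact p.Prime] :
    LocalCohomologyDelta f (PR f) :=
  cechClass (diagGen f) (toPR f (pDerivation p (polyDiff f))) p

/-- The map `H^{d+1}_{Δ_R}(P_R) → H^{d+1}_{Δ_R}(P_R / pP_R)` induced by the canonical
surjection. -/
def reductionMap [Fintype σ] [DecidableEq σ] (p : ℕ) :
    LocalCohomologyDelta f (PR f) →ₗ[PR f]
      LocalCohomologyDelta f (PR f ⧸ Ideal.span {(p : PR f)}) :=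
  TopLocalCohomology.map (diagGen f) (Submodule.mkQ (Ideal.span {(p : PR f)}))

end Enveloping

end FrobTrace

end

/-! Write `S = ℤ[x]`, `R = S/(f)`, and let `T` be `R` or `R/p²R`, with `z = y - x`.

Over `T`, a differential operator `δ` is the same thing as a `T`-linear functional on `T[z]` that
vanishes on a power of `(z)` and on the multiples of `f(x + z)`: the functional sends the Taylor
expansion `s(x + z)` to `δ(s)` (`diffFunctional`, `isDiffOpOfOrderLE_of_coeff`). As `T[z]/(z_i^M)` is
self-dual over `T` by the coefficient of `(∏ z_i)^(M-1)` (`exists_coeff_topExp_mul_eq`), such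
functionals are given by polynomials `g` with `g f(x + z) ∈ (z_i^M)`. By Taylor's formula, the
operator `∂_{p-1,…,p-1} ∘ f^(p-1)` corresponds to `f(x + z)^(p-1)` for `M = p`, hence to
`(∏ z_i)^k f(x + z)^(p-1)` for `M = p + k`. So the trace lifts if and only if, for some `k`, there is
`g = (∏ z_i)^k f(x + z)^(p-1) + p h` with `g f(x + z) ∈ (z_i^(p+k))`
(`liftsToDiffOp_iff_exists_coeff`).

Since `f(x) = 0` in `T` and `Λ_p` maps `f(y) - f(x) ∈ (z_i)` into `(z_i^p)`, it follows
that `f(x + z)^p ≡ -p φ_p(f(y) - f(x))` modulo `(z_i^p)` (`taylor_pow_add_mem`). The condition on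
`g` thus says that `p (h f(x + z) - (∏ z_i)^k φ_p(f(y) - f(x)))` lies in `(z_i^(p+k))`. The quotient
`T[z]/(z_i^(p+k))` is free over `T`, so `p` can be cancelled up to the annihilator of `p` in `T`, which
is `0` for `T = R` and `pT` for `T = R/p²R` (`liftsToDiffOp_iff_exists_mul`).

What remains is `(∏ z_i)^k φ_p(f(y) - f(x)) ∈ (f(x), f(y), z_i^(p+k))`, respectively
`(f(x), f(y), z_i^(p+k), p)`, in `ℤ[x, y]`. This is the vanishing of the class in top local
cohomology, by the description of the zero class in the Čech complex (`cechClass_eq_zero_iff`).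
-/

open scoped TensorProduct

namespace FrobTrace

/-! ### Zero classes in top local cohomology -/

section Cech

variable {A : Type*} [CommRing A] {ι : Type*} [Fintype ι]
  {M : Type*} [AddCommGroup M] [Module A M]

/-- The fraction `m / (z₀⋯z_t)^N`. -/
def fullFrac (z : ι → A) (m : M) (N : ℕ) : LocalizedModule (fullPowers z) M :=
  LocalizedModule.mk m ⟨(∏ j, z j) ^ N, N, rfl⟩

theorem fullFrac_add (z : ι → A) (m m' : M) (N : ℕ) :
    fullFrac z (m + m') N = fullFrac z m N + fullFrac z m' N := by
  rw [fullFrac, fullFrac, fullFrac, LocalizedModule.mk_add_mk, LocalizedModule.mk_eq]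
  refine ⟨1, ?_⟩
  simp only [Submonoid.smul_def, one_smul, smul_smul, smul_add, Submonoid.coe_mul]

theorem fullFrac_eq_smul_add (z : ι → A) (m : M) (N k : ℕ) :
    fullFrac z m N = fullFrac z ((∏ j, z j) ^ k • m) (N + k) := by
  rw [fullFrac, fullFrac, LocalizedModule.mk_eq]
  refine ⟨1, ?_⟩
  simp only [Submonoid.smul_def, one_smul, smul_smul, pow_add]

variable [DecidableEq ι]

/-- Multiplication by `(z₀⋯z_t)^k` raises the exponents of the generators by `k`: these are the
transition maps of the direct system that computes top local cohomology. -/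
theorem prod_pow_mul_mem_span_pow (z : ι → A) {N k : ℕ} {r : A}
    (hr : r ∈ Ideal.span (Set.range fun i => z i ^ N)) :
    (∏ j, z j) ^ k * r ∈ Ideal.span (Set.range fun i => z i ^ (N + k)) := by
  induction hr using Submodule.span_induction with
  | mem x hx =>
    obtain ⟨i, rfl⟩ := hx
    have h : (∏ j, z j) ^ k * z i ^ N = (∏ j ∈ Finset.univ.erase i, z j) ^ k * z i ^ (N + k) := by
      rw [← Finset.mul_prod_erase Finset.univ z (Finset.mem_univ i)]
      ring
    exact h ▸ Ideal.mul_mem_left _ _ (Ideal.subset_span ⟨i, rfl⟩)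
  | zero => rw [mul_zero]; exact zero_mem _
  | add x y _ _ hx hy => rw [mul_add]; exact add_mem hx hy
  | smul a x _ hx => rw [smul_eq_mul, mul_left_comm]; exact Ideal.mul_mem_left _ a hx

theorem prod_pow_smul_mem (z : ι → A) {N : ℕ} (k : ℕ) {w : M}
    (hw : w ∈ Ideal.span (Set.range fun i => z i ^ N) • (⊤ : Submodule A M)) :
    (∏ j, z j) ^ k • w ∈ Ideal.span (Set.range fun i => z i ^ (N + k)) • (⊤ : Submodule A M) := by
  induction hw using Submodule.smul_induction_on' with
  | smul r hr m _ =>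
    rw [smul_smul]
    exact Submodule.smul_mem_smul (prod_pow_mul_mem_span_pow z hr) trivial
  | add x _ y _ hx hy => rw [smul_add]; exact add_mem hx hy

theorem cechFace_mk (z : ι → A) (i : ι) (m : M) (N : ℕ) :
    cechFace z M i (LocalizedModule.mk m
        (⟨(∏ j ∈ Finset.univ.erase i, z j) ^ N, N, rfl⟩ : facePowers z i)) =
      fullFrac z (z i ^ N • m) N := by
  rw [fullFrac, cechFace, LocalizedModule.lift_mk, Module.End.algebraMap_isUnit_inv_apply_eq_iff]
  rw [LocalizedModule.mkLinearMap_apply, LocalizedModule.smul'_mk, smul_smul,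
    ← mul_pow, mul_comm, Finset.mul_prod_erase _ _ (Finset.mem_univ i)]
  exact (LocalizedModule.mk_cancel (S := fullPowers z) ⟨(∏ j, z j) ^ N, N, rfl⟩ m).symm

theorem mk_mem_cechBoundary (z : ι → A) {N : ℕ} {w : M}
    (hw : w ∈ Ideal.span (Set.range fun i => z i ^ N) • (⊤ : Submodule A M)) :
    fullFrac z w N ∈ cechBoundary z M := by
  induction hw using Submodule.smul_induction_on' with
  | smul r hr m _ =>
    induction hr using Submodule.span_induction generalizing m with
    | mem x hx =>
      obtain ⟨i, rfl⟩ := hx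
      exact Submodule.mem_iSup_of_mem i ⟨_, cechFace_mk z i m N⟩
    | zero => rw [zero_smul, fullFrac, LocalizedModule.zero_mk]; exact zero_mem _
    | add x y _ _ hx hy =>
      rw [add_smul, fullFrac_add]; exact add_mem (hx m trivial) (hy m trivial)
    | smul a x _ hx => 
      rw [smul_assoc, fullFrac, ← LocalizedModule.smul'_mk]
      exact Submodule.smul_mem _ a (hx m trivial)
  | add x _ y _ hx hy => rw [fullFrac_add]; exact add_mem hx hy

theorem exists_of_mem_cechBoundary (z : ι → A) {x : LocalizedModule (fullPowers z) M}
    (hx : x ∈ cechBoundary z M) :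
    ∃ (N : ℕ) (w : M), w ∈ Ideal.span (Set.range fun i => z i ^ N) • (⊤ : Submodule A M) ∧
      x = fullFrac z w N := by
  induction hx using Submodule.iSup_induction' with
  | mem i x hx =>
    obtain ⟨y, rfl⟩ := hx
    induction y using LocalizedModule.induction_on with
    | _ m s =>
      obtain ⟨_, N, rfl⟩ := s
      exact ⟨N, z i ^ N • m, Submodule.smul_mem_smul (Ideal.subset_span ⟨i, rfl⟩) trivial,
        cechFace_mk z i m N⟩
  | zero => exact ⟨0, 0, zero_mem _, (LocalizedModule.zero_mk _).symm⟩
  | add x y _ _ hx hy =>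
    obtain ⟨N, w, hw, rfl⟩ := hx
    obtain ⟨N', w', hw', rfl⟩ := hy
    refine ⟨N + N', (∏ j, z j) ^ N' • w + (∏ j, z j) ^ N • w',
      add_mem (prod_pow_smul_mem z N' hw) ?_, ?_⟩
    · rw [add_comm N N']; exact prod_pow_smul_mem z N hw'
    · rw [fullFrac_eq_smul_add z w N N', fullFrac_eq_smul_add z w' N' N, add_comm N' N,
        fullFrac_add]

/-- A class `m / (z₀⋯z_t)^n` in top local cohomology vanishes exactly if
`(z₀⋯z_t)^k m ∈ (z₀^(n+k), …, z_t^(n+k)) M` for some `k`. -/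
theorem cechClass_eq_zero_iff (z : ι → A) (m : M) (n : ℕ) :
    cechClass z m n = 0 ↔ ∃ k : ℕ, (∏ j, z j) ^ k • m ∈
      Ideal.span (Set.range fun i => z i ^ (n + k)) • (⊤ : Submodule A M) := by
  rw [cechClass]
  refine (Submodule.Quotient.mk_eq_zero (cechBoundary z M)).trans ⟨fun h => ?_, ?_⟩
  · obtain ⟨N, w, hw, h⟩ := exists_of_mem_cechBoundary z h
    rw [fullFrac, LocalizedModule.mk_eq] at h
    obtain ⟨⟨_, e, rfl⟩, h⟩ := h
    simp only [Submonoid.smul_def, smul_smul, ← pow_add] at h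
    refine ⟨e + N, ?_⟩
    rw [h]
    convert prod_pow_smul_mem z (e + n) hw using 6
    ring
  · rintro ⟨k, hk⟩
    change fullFrac z m n ∈ cechBoundary z M
    rw [fullFrac_eq_smul_add z m n k]
    exact mk_mem_cechBoundary z hk

end Cech

/-! ### The ideals `(z_i ^ M)` of a polynomial ring -/

open MvPolynomial

noncomputable section

section Box

variable {σ : Type*} [Fintype σ] {T : Type*} [CommRing T]

/-- The exponent `(n, …, n)`. -/
abbrev topExp (σ : Type*) [Fintype σ] (n : ℕ) : σ →₀ ℕ :=
  Finsupp.equivFunOnFinite.symm fun _ => n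

variable (σ T) in
/-- The ideal of `T[z]` generated by the powers `z_i ^ M`. -/
def boxIdeal (M : ℕ) : Ideal (MvPolynomial σ T) :=
  Ideal.span (Set.range fun i => X i ^ M)

omit [Fintype σ] in
theorem boxIdeal_le_pow_span_X (M : ℕ) :
    boxIdeal σ T M ≤ Ideal.span (Set.range (X : σ → MvPolynomial σ T)) ^ M := by
  refine Ideal.span_le.mpr ?_
  rintro _ ⟨i, rfl⟩
  exact Ideal.pow_mem_pow (Ideal.subset_span (Set.mem_range_self i)) M

theorem mem_boxIdeal_iff {n : ℕ} {g : MvPolynomial σ T} :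
    g ∈ boxIdeal σ T (n + 1) ↔ ∀ a ≤ topExp σ n, coeff a g = 0 := by
  have h : (Set.range fun i : σ => (X i ^ (n + 1) : MvPolynomial σ T)) =
      (fun s => monomial s (1 : T)) '' Set.range fun i => Finsupp.single i (n + 1) := by
    rw [← Set.range_comp]
    simp [X_pow_eq_monomial, Function.comp_def]
  rw [boxIdeal, h, mem_ideal_span_monomial_image]
  constructor
  · intro hg a ha
    by_contra hne
    obtain ⟨_, ⟨i, rfl⟩, hi⟩ := hg a (mem_support_iff.mpr hne)
    have := ha i
    rw [Finsupp.single_le_iff] at hi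
    simp at this
    omega
  · intro hg a ha
    by_contra! hne
    refine mem_support_iff.mp ha (hg a fun i => ?_)
    have := hne _ ⟨i, rfl⟩
    rw [Finsupp.single_le_iff] at this
    simp
    omega

/-- Membership in `(z_i ^ (n + 1), κ)` from the coefficients with all exponents at most `n`. -/
theorem mem_boxIdeal_of_coeff_mem {n : ℕ} {κ : T} {g : MvPolynomial σ T}
    (h : ∀ a ≤ topExp σ n, coeff a g ∈ Ideal.span {κ}) :
    g ∈ boxIdeal σ T (n + 1) ⊔ Ideal.span {C κ} := by
  classical
  rw [g.as_sum]
  refine Ideal.sum_mem _ fun a _ => ?_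
  by_cases ha : a ≤ topExp σ n
  · obtain ⟨t, ht⟩ := Ideal.mem_span_singleton.mp (h a ha)
    refine Ideal.mem_sup_right (Ideal.mem_span_singleton.mpr ⟨monomial a t, ?_⟩)
    rw [ht, C_mul_monomial]
  · refine Ideal.mem_sup_left (mem_boxIdeal_iff.mpr fun b hb => ?_)
    rw [coeff_monomial, if_neg]
    rintro rfl
    exact ha hb

theorem prod_X_pow_mul_mem_boxIdeal [DecidableEq σ] {M k : ℕ} {g : MvPolynomial σ T}
    (hg : g ∈ boxIdeal σ T M) :
    (∏ i, X i) ^ k * g ∈ boxIdeal σ T (M + k) :=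
  prod_pow_mul_mem_span_pow _ hg

theorem prod_X_pow_eq_monomial (k : ℕ) :
    (∏ i, X i : MvPolynomial σ T) ^ k = monomial (topExp σ k) 1 := by
  rw [← Finset.prod_pow, monomial_eq, C_1, one_mul, Finsupp.prod_fintype _ _ (by simp)]
  simp

theorem coeff_topExp_prod_X_pow_mul (n k : ℕ) (g : MvPolynomial σ T) :
    coeff (topExp σ (n + k)) ((∏ i, X i) ^ k * g) = coeff (topExp σ n) g := by
  have : topExp σ (n + k) = topExp σ k + topExp σ n := by
    ext i; simp [add_comm]
  rw [prod_X_pow_eq_monomial, this, coeff_monomial_mul, one_mul]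

theorem coeff_topExp_eq_zero {n : ℕ} {g : MvPolynomial σ T} (hg : g ∈ boxIdeal σ T (n + 1)) :
    coeff (topExp σ n) g = 0 :=
  mem_boxIdeal_iff.mp hg _ le_rfl

theorem coeff_topExp_mul_monomial {n : ℕ} {a : σ →₀ ℕ} (ha : a ≤ topExp σ n)
    (g : MvPolynomial σ T) :
    coeff (topExp σ n) (g * monomial (topExp σ n - a) 1) = coeff a g := by
  rw [coeff_mul_monomial', if_pos tsub_le_self, tsub_tsub_cancel_of_le ha, mul_one]

/-- `T[z] / (z_i ^ (n + 1))` is self-dual over `T`, by the coefficient of `z ^ (n, …, n)`: every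
functional vanishing on `(z_i ^ (n + 1))` is a multiple of that coefficient. -/
theorem exists_coeff_topExp_mul_eq {n : ℕ} (L : MvPolynomial σ T →ₗ[T] T)
    (hL : ∀ g ∈ boxIdeal σ T (n + 1), L g = 0) :
    ∃ g : MvPolynomial σ T, ∀ h, coeff (topExp σ n) (g * h) = L h := by
  classical
  -- The monomials `z^a` and `z^((n, …, n) - a)` form dual bases for the pairing.
  refine ⟨∑ a ∈ Finset.Iic (topExp σ n), monomial (topExp σ n - a) (L (monomial a 1)), fun h => ?_⟩
  induction h using MvPolynomial.induction_on' with
  | add p q hp hq => rw [mul_add, coeff_add, hp, hq, map_add]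
  | monomial b t =>
    have ht : L (monomial b t) = t * L (monomial b 1) := by
      rw [← smul_eq_mul, ← map_smul, smul_monomial, smul_eq_mul, mul_one]
    rw [Finset.sum_mul, coeff_sum, ht]
    by_cases hb : b ≤ topExp σ n
    · rw [Finset.sum_eq_single b]
      · rw [monomial_mul, tsub_add_cancel_of_le hb, coeff_monomial, if_pos rfl, mul_comm]
      · intro a ha hab
        rw [Finset.mem_Iic] at ha
        rw [monomial_mul, coeff_monomial, if_neg]
        intro h
        apply hab
        rw [← add_right_inj (topExp σ n - a), tsub_add_cancel_of_le ha, h]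
      · intro h
        exact absurd (Finset.mem_Iic.mpr hb) h
    · rw [hL (monomial b 1), mul_zero]
      · refine Finset.sum_eq_zero fun a ha => ?_
        rw [monomial_mul, coeff_monomial, if_neg]
        intro h
        exact hb (h ▸ le_add_self)
      · refine mem_boxIdeal_iff.mpr fun c hc => ?_
        rw [coeff_monomial, if_neg]
        rintro rfl
        exact hb hc

theorem exists_pow_span_X_le_boxIdeal (M : ℕ) :
    ∃ m : ℕ, Ideal.span (Set.range (X : σ → MvPolynomial σ T)) ^ m ≤ boxIdeal σ T M := by
  refine Ideal.exists_pow_le_of_le_radical_of_fg ?_ ?_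
  · rw [Ideal.span_le]
    rintro _ ⟨i, rfl⟩
    exact ⟨M, Ideal.subset_span ⟨i, rfl⟩⟩
  · exact ⟨(Set.finite_range X).toFinset, by simp⟩

end Box

/-! ### Taylor expansions -/

section Taylor

variable {σ : Type*} {T : Type*} [CommRing T] (q : MvPolynomial σ ℤ →+* T)

/-- The Taylor expansion `s(x) ↦ s(x + z)` with coefficients in `T`, where `x` is read in `T`
through `q : ℤ[x] → T`. -/
def taylor : MvPolynomial σ ℤ →ₐ[ℤ] MvPolynomial σ T :=
  aeval fun i => C (q (X i)) + X i

theorem taylor_X (i : σ) : taylor q (X i) = C (q (X i)) + X i := by simp [taylor]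

theorem coeff_prod_C_add_X_pow [Fintype σ] (u : σ → T) (b a : σ →₀ ℕ) :
    coeff a (∏ i, (C (u i) + X i) ^ b i : MvPolynomial σ T) =
      ∏ i, (u i ^ (b i - a i) * ((b i).choose (a i) : T)) := by
  classical
  have h1 : ∀ i, (C (u i) + X i : MvPolynomial σ T) ^ b i = ∑ j ∈ Finset.range (b i + 1),
      monomial (Finsupp.single i j) (u i ^ (b i - j) * ((b i).choose j : T)) := by
    intro i
    rw [add_comm, add_pow]
    refine Finset.sum_congr rfl fun j _ => ?_
    rw [X_pow_eq_monomial, ← C_pow, ← map_natCast (C : T →+* MvPolynomial σ T), mul_assoc,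
      ← C_mul, mul_comm, C_mul_monomial, mul_one]
  simp_rw [h1]
  rw [Finset.prod_univ_sum, coeff_sum]
  have h2 : ∀ c : σ → ℕ,
      (∏ i, monomial (Finsupp.single i (c i)) (u i ^ (b i - c i) * ((b i).choose (c i) : T)) :
        MvPolynomial σ T) = monomial (Finsupp.equivFunOnFinite.symm c)
          (∏ i, (u i ^ (b i - c i) * ((b i).choose (c i) : T))) := by
    intro c
    rw [← monomial_sum_prod]
    congr 2
    ext i
    simp [Finsupp.finsetSum_apply, Finsupp.single_apply]
  simp_rw [h2, coeff_monomial]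
  rw [Finset.sum_eq_single (a : σ → ℕ)]
  · rw [if_pos (by ext; simp)]
  · intro c _ hc
    rw [if_neg]
    rintro rfl
    simp at hc
  · intro ha
    rw [if_pos (by ext; simp)]
    rw [Fintype.mem_piFinset] at ha
    push Not at ha
    obtain ⟨i, hi⟩ := ha
    rw [Finset.mem_range, not_lt] at hi
    refine Finset.prod_eq_zero (Finset.mem_univ i) ?_
    rw [Nat.choose_eq_zero_of_lt hi, Nat.cast_zero, mul_zero]

/-- Taylor's formula `s(x + z) = ∑ ∂_a(s)(x) z^a`. -/
theorem coeff_taylor [Fintype σ] (a : σ →₀ ℕ) (s : MvPolynomial σ ℤ) :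
    coeff a (taylor q s) = q (dividedPartial ℤ a s) := by
  induction s using MvPolynomial.induction_on' with
  | add s t hs ht => rw [map_add, coeff_add, hs, ht, map_add, map_add]
  | monomial b c =>
    rw [dividedPartial_monomial, monomial_eq, monomial_eq, map_mul,
      Finsupp.prod_fintype _ _ (by simp), Finsupp.prod_fintype _ _ (by simp), map_prod]
    simp_rw [map_pow, taylor_X]
    have hc : taylor q (C c) = C (q (C c)) := by simp [taylor]
    rw [hc, coeff_C_mul, coeff_prod_C_add_X_pow, Finset.prod_mul_distrib]
    simp only [map_mul, map_prod, map_pow, Finsupp.coe_tsub, Pi.sub_apply, map_natCast]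
    ring

theorem taylor_sub_C_mem (s : MvPolynomial σ ℤ) :
    taylor q s - C (q s) ∈ Ideal.span (Set.range (X : σ → MvPolynomial σ T)) := by
  rw [← Ideal.Quotient.mk_eq_mk_iff_sub_mem]
  refine DFunLike.congr_fun (f := (Ideal.Quotient.mk _).comp (RingHomClass.toRingHom (taylor q)))
    (g := (Ideal.Quotient.mk _).comp (C.comp q)) (ringHom_ext' (RingHom.ext_int _ _) fun i => ?_) s
  refine Ideal.Quotient.eq.mpr (Ideal.subset_span ⟨i, ?_⟩)
  simp [taylor_X]

/-- The Taylor expansions span `T[z]` over `T`, since `z_i` is the expansion of `x_i` minus a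
constant. -/
theorem span_range_taylor : Submodule.span T (Set.range (taylor q)) = ⊤ := by
  have hclosure : (Submonoid.closure (Set.range (taylor q)) : Set (MvPolynomial σ T)) =
      Set.range (taylor q) := by
    exact congrArg SetLike.coe (Submonoid.closure_eq
      (MonoidHom.mrange (taylor q : MvPolynomial σ ℤ →* MvPolynomial σ T)))
  rw [← hclosure, ← Algebra.adjoin_eq_span, ← Algebra.top_toSubmodule]
  congr 1
  rw [eq_top_iff, ← adjoin_range_X, Algebra.adjoin_le_iff]
  rintro _ ⟨i, rfl⟩
  have : (X i : MvPolynomial σ T) = taylor q (X i) - algebraMap T _ (q (X i)) := by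
    rw [taylor_X, algebraMap_eq, add_sub_cancel_left]
  rw [this]
  exact sub_mem (Algebra.subset_adjoin ⟨_, rfl⟩) (Subalgebra.algebraMap_mem _ _)

end Taylor

/-! ### Differential operators as functionals on Taylor expansions -/

section Functional

variable {σ : Type*} {T : Type*} [CommRing T] (q : MvPolynomial σ ℤ →+* T)

/-- The `T`-linear functional on `T[z]` attached to an additive map `δ : T → T`: it sends the
Taylor expansion of `s` to `δ (q s)`. In the coordinates `y = x + z` it is the `T`-linear map
with `y^b ↦ δ (x^b)`. -/
def diffFunctional (δ : AddEnd T) : MvPolynomial σ T →ₗ[T] T :=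
  ((basisMonomials σ T).constr T fun b => δ (q (monomial b 1))) ∘ₗ
    (aeval fun i => X i - C (q (X i)) : MvPolynomial σ T →ₐ[T] MvPolynomial σ T).toLinearMap

theorem diffFunctional_taylor (δ : AddEnd T) (s : MvPolynomial σ ℤ) :
    diffFunctional q δ (taylor q s) = δ (q s) := by
  have hw : (aeval fun i => X i - C (q (X i)) : MvPolynomial σ T →ₐ[T] MvPolynomial σ T)
      (taylor q s) = map (Int.castRingHom T) s := by
    refine DFunLike.congr_fun (f := (RingHomClass.toRingHom (aeval fun i => X i - C (q (X i)) :
        MvPolynomial σ T →ₐ[T] MvPolynomial σ T)).comp (RingHomClass.toRingHom (taylor q)))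
      (g := map (Int.castRingHom T)) (ringHom_ext' (RingHom.ext_int _ _) fun i => ?_) s
    simp [taylor_X]
  rw [diffFunctional, LinearMap.comp_apply, AlgHom.toLinearMap_apply, hw]
  clear hw
  induction s using MvPolynomial.induction_on' with
  | add s t hs ht => simp only [map_add, hs, ht]
  | monomial b c =>
    have h1 : map (Int.castRingHom T) (monomial b c) = (c : T) • basisMonomials σ T b := by
      simp [smul_monomial]
    have h2 : q (monomial b c) = c • q (monomial b 1) := by
      rw [← map_zsmul, smul_monomial, smul_eq_mul, mul_one]
    rw [h1, map_smul, Module.Basis.constr_basis, h2, map_zsmul, zsmul_eq_mul, smul_eq_mul]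

theorem diffFunctional_zero : diffFunctional q 0 = 0 := by
  refine LinearMap.ext_on (span_range_taylor q) ?_
  rintro _ ⟨s, rfl⟩
  rw [diffFunctional_taylor]
  rfl

/-- Multiplication by `s(x + z)` on functionals is precomposition with multiplication by `s`. -/
theorem diffFunctional_taylor_mul (δ : AddEnd T) (s : MvPolynomial σ ℤ) (h : MvPolynomial σ T) :
    diffFunctional q δ (taylor q s * h) =
      diffFunctional q (δ.comp (AddMonoidHom.mulLeft (q s))) h := by
  refine LinearMap.congr_fun (f := diffFunctional q δ ∘ₗ LinearMap.mulLeft T (taylor q s))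
    (LinearMap.ext_on (span_range_taylor q) ?_) h
  rintro _ ⟨t, rfl⟩
  simp [← map_mul, diffFunctional_taylor]

/-- Multiplication by `z_i` on functionals is, up to sign, the commutator with `x_i`. -/
theorem diffFunctional_X_mul (δ : AddEnd T) (i : σ) (h : MvPolynomial σ T) :
    diffFunctional q δ (X i * h) =
      - diffFunctional q ((AddMonoidHom.mulLeft (q (X i))).comp δ -
        δ.comp (AddMonoidHom.mulLeft (q (X i)))) h := by
  refine LinearMap.congr_fun (f := diffFunctional q δ ∘ₗ LinearMap.mulLeft T (X i))
    (g := - diffFunctional q _) (LinearMap.ext_on (span_range_taylor q) ?_) h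
  rintro _ ⟨t, rfl⟩
  have hX : (X i : MvPolynomial σ T) = taylor q (X i) - C (q (X i)) := by
    rw [taylor_X, add_sub_cancel_left]
  simp only [LinearMap.comp_apply, LinearMap.mulLeft_apply, LinearMap.neg_apply]
  rw [hX, sub_mul, map_sub, ← map_mul (taylor q), ← smul_eq_C_mul, map_smul,
    diffFunctional_taylor, diffFunctional_taylor, diffFunctional_taylor, map_mul]
  simp

/-- The functional of a differential operator of order at most `n` vanishes on `(z)^(n + 1)`. -/
theorem diffFunctional_eq_zero_of_mem_pow {n : ℕ} {δ : AddEnd T} (hδ : IsDiffOpOfOrderLE n δ)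
    {h : MvPolynomial σ T} (hh : h ∈ Ideal.span (Set.range (X : σ → MvPolynomial σ T)) ^ (n + 1)) :
    diffFunctional q δ h = 0 := by
  induction n generalizing δ h with
  | zero =>
    -- Multiplication by `r` has functional `h ↦ r h(0)`.
    obtain ⟨r, rfl⟩ := hδ
    rw [zero_add, pow_one] at hh
    have key : diffFunctional q (AddMonoidHom.mulLeft r) =
        r • (aeval (0 : σ → T) : MvPolynomial σ T →ₐ[T] T).toLinearMap := by
      refine LinearMap.ext_on (span_range_taylor q) ?_
      rintro _ ⟨t, rfl⟩
      have h0 : aeval (0 : σ → T) (taylor q t) = q t := by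
        refine DFunLike.congr_fun (f := (RingHomClass.toRingHom (aeval (0 : σ → T))).comp
          (RingHomClass.toRingHom (taylor q))) (g := q)
          (ringHom_ext' (RingHom.ext_int _ _) fun i => ?_) t
        simp [taylor_X]
      rw [diffFunctional_taylor, LinearMap.smul_apply, AlgHom.toLinearMap_apply, h0]
      rfl
    have h0 : Ideal.span (Set.range (X : σ → MvPolynomial σ T)) ≤
        RingHom.ker (aeval (0 : σ → T)) := by
      rw [Ideal.span_le]
      rintro _ ⟨i, rfl⟩
      simp
    rw [key, LinearMap.smul_apply, AlgHom.toLinearMap_apply, h0 hh, smul_zero]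
  | succ n ih =>
    rw [pow_succ'] at hh
    induction hh using Submodule.mul_induction_on' with
    | add x _ y _ hx hy => rw [map_add, hx, hy, add_zero]
    | mem_mul_mem g hg h hh =>
      induction hg using Submodule.span_induction generalizing h with
      | mem x hx =>
        obtain ⟨i, rfl⟩ := hx
        rw [diffFunctional_X_mul, ih (hδ _) hh, neg_zero]
      | zero => rw [zero_mul, map_zero]
      | add x y _ _ hx hy => rw [add_mul, map_add, hx h hh, hy h hh, add_zero]
      | smul a x _ hx =>
        rw [smul_mul_assoc, smul_eq_mul, mul_left_comm]
        exact hx _ (Ideal.mul_mem_left _ _ hh)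

variable [Fintype σ]

/-- An additive map of the form `s ↦ coeff_{z^(N, …, N)} (g · s(x + z))` is a differential operator
of order at most `n` as soon as `g · (z)^(n + 1)` lies in `(z_i ^ (N + 1))`. -/
theorem isDiffOpOfOrderLE_of_coeff (hq : Function.Surjective q) {N n : ℕ} {δ : AddEnd T}
    {g : MvPolynomial σ T}
    (hg : ∀ h ∈ Ideal.span (Set.range (X : σ → MvPolynomial σ T)) ^ (n + 1),
      g * h ∈ boxIdeal σ T (N + 1))
    (hδ : ∀ s, δ (q s) = coeff (topExp σ N) (g * taylor q s)) :
    IsDiffOpOfOrderLE n δ := by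
  induction n generalizing δ g with
  | zero =>
    -- Here `g · s(x + z) ≡ g · s(x)`, since `s(x + z) - s(x)` lies in `(z)`.
    refine ⟨coeff (topExp σ N) g, AddMonoidHom.ext fun t => ?_⟩
    obtain ⟨s, rfl⟩ := hq t
    have h1 := hg _ (by rw [zero_add, pow_one]; exact taylor_sub_C_mem q s)
    have h2 := coeff_topExp_eq_zero h1
    rw [mul_sub, mul_comm g (C _), coeff_sub, coeff_C_mul, sub_eq_zero] at h2
    rw [hδ, h2, mul_comm]
    rfl
  | succ n ih =>
    intro r
    obtain ⟨r, rfl⟩ := hq r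
    -- The commutator with `r` is given by `-g (r(x + z) - r(x))`.
    refine ih (g := - (g * (taylor q r - C (q r)))) (fun h hh => ?_) fun s => ?_
    · rw [neg_mul, mul_assoc]
      refine neg_mem (hg _ ?_)
      rw [pow_succ' _ (n + 1)]
      exact Ideal.mul_mem_mul (taylor_sub_C_mem q r) hh
    · have e : -(g * (taylor q r - C (q r))) * taylor q s =
          C (q r) * (g * taylor q s) - g * taylor q (r * s) := by
        rw [map_mul]; ring
      rw [e, coeff_sub, coeff_C_mul, ← hδ, ← hδ, map_mul]
      rfl

end Functional

/-! ### The lifting criterion -/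

section Criterion

variable {σ : Type*} [Fintype σ] [DecidableEq σ] {T : Type*} [CommRing T]
  {q : MvPolynomial σ ℤ →+* T} {f : MvPolynomial σ ℤ} {p : ℕ} [Fact p.Prime]
  {R' : Type*} [CommRing R'] {π : T →+* R'} {Φ : AddEnd R'}

omit [DecidableEq σ] in
/-- Lifts of the Frobenius trace correspond to polynomials `g` in `z`, through
`s ↦ coeff_{z^(N, …, N)} (g · s(x + z))` with `N = p + k - 1`: that this map descends to `T` means
that `g · f(x + z)` vanishes modulo `(z_i ^ (p + k))`, and that it lifts the trace
determines `g` modulo `p`. The integer `m` is `0` for `T = R` and `p²` for `T = R/p²R`. -/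
theorem liftsToDiffOp_iff_exists_coeff (hq : Function.Surjective q) (hf : q f = 0) {m : ℕ}
    (hm : (m : T) = 0) (hker : ∀ s, q s = 0 → s ∈ Ideal.span {f, (m : MvPolynomial σ ℤ)})
    (hπ : ∀ t, π t = 0 ↔ (p : T) ∣ t)
    (hΦ : ∀ s, Φ (π (q s)) = π (q (polyTrace p σ ℤ (f ^ (p - 1) * s)))) :
    LiftsToDiffOp π Φ ↔ ∃ (k : ℕ) (g : MvPolynomial σ T),
      g * taylor q f ∈ boxIdeal σ T (p + k) ∧
      g - (∏ i, X i) ^ k * taylor q f ^ (p - 1) ∈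
        boxIdeal σ T (p + k) ⊔ Ideal.span {C (p : T)} := by
  have hpos := (Fact.out : p.Prime).pos
  have hpk : ∀ k, p + k = (p - 1 + k) + 1 := fun k => by omega
  have hcoeff : ∀ k s, π (coeff (topExp σ (p - 1 + k))
      ((∏ i, X i) ^ k * taylor q f ^ (p - 1) * taylor q s)) = Φ (π (q s)) := by
    intro k s
    rw [mul_assoc, coeff_topExp_prod_X_pow_mul, ← map_pow, ← map_mul, coeff_taylor, hΦ]
    rfl
  constructor
  · rintro ⟨δ, ⟨n, hn⟩, hδ⟩
    -- With `k = n + 1`, the ideal `(z_i ^ (p + k))` lies in `(z)^(n + 1)`, which the functional of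
    -- `δ` kills.
    obtain ⟨g, hg⟩ := exists_coeff_topExp_mul_eq (n := p - 1 + (n + 1)) (diffFunctional q δ)
      fun h hh => diffFunctional_eq_zero_of_mem_pow q hn
        (Ideal.pow_le_pow_right (by omega) (boxIdeal_le_pow_span_X _ hh))
    refine ⟨n + 1, g, ?_, ?_⟩
    · rw [hpk, mem_boxIdeal_iff]
      intro a ha
      have h0 : δ.comp (AddMonoidHom.mulLeft (q f)) = 0 := by
        ext t
        simp [hf]
      rw [← coeff_topExp_mul_monomial ha, mul_assoc, hg, diffFunctional_taylor_mul, h0,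
        diffFunctional_zero, LinearMap.zero_apply]
    · rw [hpk]
      refine mem_boxIdeal_of_coeff_mem fun a ha => ?_
      rw [← coeff_topExp_mul_monomial ha, Ideal.mem_span_singleton, ← hπ, sub_mul, coeff_sub, map_sub,
        sub_eq_zero]
      -- Both sides are `T`-linear up to `π`, so they are compared on Taylor expansions, which span.
      have hmem : monomial (topExp σ (p - 1 + (n + 1)) - a) 1 ∈
          Submodule.span T (Set.range (taylor q)) := span_range_taylor q ▸ trivial
      generalize monomial (topExp σ (p - 1 + (n + 1)) - a) (1 : T) = w at hmem ⊢
      induction hmem using Submodule.span_induction with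
      | mem x hx =>
        obtain ⟨s, rfl⟩ := hx
        rw [hcoeff, hg, diffFunctional_taylor, hδ]
      | zero => simp
      | add x y _ _ hx hy => simp only [mul_add, coeff_add, map_add, hx, hy]
      | smul t x _ hx => simp only [mul_smul_comm, coeff_smul, smul_eq_mul, map_mul, hx]
  · rintro ⟨k, g, hgf, hgp⟩
    rw [hpk] at hgf hgp
    let δ₀ : MvPolynomial σ ℤ →+ T := (lcoeff T (topExp σ (p - 1 + k))).toAddMonoidHom.comp
      ((AddMonoidHom.mulLeft g).comp (taylor q : MvPolynomial σ ℤ →+ MvPolynomial σ T))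
    have hδ₀ : ∀ s, δ₀ s = coeff (topExp σ (p - 1 + k)) (g * taylor q s) := fun s => rfl
    have hle : (q : MvPolynomial σ ℤ →+ T).ker ≤ δ₀.ker := by
      intro s hs
      obtain ⟨a, b, rfl⟩ := Ideal.mem_span_pair.mp (hker s hs)
      rw [AddMonoidHom.mem_ker, hδ₀]
      refine coeff_topExp_eq_zero ?_
      have hm' : taylor q (m : MvPolynomial σ ℤ) = 0 := by
        rw [map_natCast, ← map_natCast (C : T →+* MvPolynomial σ T), hm, map_zero]
      rw [map_add, map_mul, map_mul, hm', mul_zero, add_zero, mul_left_comm]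
      exact Ideal.mul_mem_left _ _ hgf
    let δ := AddMonoidHom.liftOfSurjective (q : MvPolynomial σ ℤ →+ T) hq ⟨δ₀, hle⟩
    have hδ : ∀ s, δ (q s) = coeff (topExp σ (p - 1 + k)) (g * taylor q s) :=
      AddMonoidHom.liftOfRightInverse_comp_apply _ _ _ ⟨δ₀, hle⟩
    obtain ⟨n, hn⟩ := exists_pow_span_X_le_boxIdeal (σ := σ) (T := T) (p - 1 + k + 1)
    refine ⟨δ, ⟨n, isDiffOpOfOrderLE_of_coeff q hq (fun h hh => ?_) hδ⟩, fun t => ?_⟩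
    · exact Ideal.mul_mem_left _ _ (hn (Ideal.pow_le_pow_right n.le_succ hh))
    · obtain ⟨s, rfl⟩ := hq t
      rw [hδ, ← hcoeff k, ← sub_eq_zero, ← map_sub, hπ, ← coeff_sub, ← sub_mul]
      obtain ⟨j, hj, r, hr, hjr⟩ := Submodule.mem_sup.mp hgp
      obtain ⟨r, rfl⟩ := Ideal.mem_span_singleton.mp hr
      rw [← hjr, add_mul, coeff_add, coeff_topExp_eq_zero (Ideal.mul_mem_right _ _ hj), zero_add,
        mul_assoc, coeff_C_mul]
      exact dvd_mul_right _ _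

/-! ### The expansion of `ℤ[x, y]` along the diagonal and the `p`-derivation -/

variable (q) in
/-- The map `ℤ[x, y] → T[z]` with `x_i ↦ x_i` and `y_i ↦ x_i + z_i`, where `x` is read in `T` through
`q : ℤ[x] → T`. -/
def diagExpansion : PS σ →ₐ[ℤ] MvPolynomial σ T :=
  aeval (Sum.elim (fun i => C (q (X i))) (fun i => C (q (X i)) + X i))

omit [Fintype σ] [DecidableEq σ] in
theorem diagExpansion_inl (s : MvPolynomial σ ℤ) :
    diagExpansion q (rename Sum.inl s) = C (q s) := by
  refine DFunLike.congr_fun (f := (RingHomClass.toRingHom (diagExpansion q)).comp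
    (RingHomClass.toRingHom (rename Sum.inl))) (g := C.comp q)
    (ringHom_ext' (RingHom.ext_int _ _) fun i => ?_) s
  simp [diagExpansion]

omit [Fintype σ] [DecidableEq σ] in
theorem diagExpansion_inr (s : MvPolynomial σ ℤ) :
    diagExpansion q (rename Sum.inr s) = taylor q s := by
  rw [diagExpansion, aeval_rename]
  rfl

omit [Fintype σ] [DecidableEq σ] in
theorem diagExpansion_sub (i : σ) : diagExpansion q (yVar i - xVar i) = X i := by
  simp [diagExpansion]

omit [Fintype σ] [DecidableEq σ] in
theorem polyDiff_mem_span (f : MvPolynomial σ ℤ) :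
    polyDiff f ∈ Ideal.span (Set.range fun i : σ => yVar i - xVar i) := by
  rw [polyDiff, ← Ideal.Quotient.mk_eq_mk_iff_sub_mem]
  refine DFunLike.congr_fun (f := (Ideal.Quotient.mk _).comp
      (RingHomClass.toRingHom (rename (R := ℤ) Sum.inr)))
    (g := (Ideal.Quotient.mk _).comp (RingHomClass.toRingHom (rename (R := ℤ) Sum.inl)))
    (ringHom_ext' (RingHom.ext_int _ _) fun i => ?_) f
  refine Ideal.Quotient.eq.mpr (Ideal.subset_span ⟨i, ?_⟩)
  simp

omit [DecidableEq σ] [Fintype σ] in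
/-- `f(x + z)^p ≡ -p φ_p(f(y) - f(x))` modulo `(z_i ^ p)`, since `Λ_p` maps `f(y) - f(x)`, which is
in the ideal of the diagonal, into `(z_i ^ p)`. -/
theorem taylor_pow_add_mem (hf : q f = 0) :
    taylor q f ^ p + C (p : T) * diagExpansion q (pDerivation p (polyDiff f)) ∈
      boxIdeal σ T p := by
  have h1 : diagExpansion q (polyDiff f) = taylor q f := by
    rw [polyDiff, map_sub, diagExpansion_inl, diagExpansion_inr, hf, map_zero, sub_zero]
  have h2 := congrArg (diagExpansion q) (pDerivation_spec p (polyDiff f))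
  rw [map_sub, map_pow, map_mul, h1, map_natCast, ← map_natCast (C : T →+* MvPolynomial σ T),
    sub_eq_iff_eq_add'] at h2
  rw [← h2]
  have h3 := Ideal.mem_map_of_mem (RingHomClass.toRingHom ((diagExpansion q).comp (frobLift p)))
    (polyDiff_mem_span f)
  rw [Ideal.map_span, ← Set.range_comp] at h3
  have e : boxIdeal σ T p = Ideal.span (Set.range
      (RingHomClass.toRingHom ((diagExpansion q).comp (frobLift p)) ∘ fun i => yVar i - xVar i)) := by
    rw [boxIdeal]
    congr! 2
    funext i
    change _ = diagExpansion q (frobLift p (yVar i - xVar i))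
    rw [frobLift_y_sub_x, map_pow, diagExpansion_sub]
  rw [e]
  exact h3

/-- The Frobenius trace lifts if and only if `z^k φ_p(f(y) - f(x))` is a multiple of `f(y)` modulo
`(z_i ^ (p + k))`, for some `k`, up to the annihilator of `p` in `T`. That annihilator is
generated by the integer `κ`, which is `0` for `T = R` and `p` for `T = R/p²R`. -/
theorem liftsToDiffOp_iff_exists_mul (hq : Function.Surjective q) (hf : q f = 0) {m : ℕ}
    (hm : (m : T) = 0) (hker : ∀ s, q s = 0 → s ∈ Ideal.span {f, (m : MvPolynomial σ ℤ)})
    (hπ : ∀ t, π t = 0 ↔ (p : T) ∣ t)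
    (hΦ : ∀ s, Φ (π (q s)) = π (q (polyTrace p σ ℤ (f ^ (p - 1) * s))))
    {κ : ℕ} (hκ : ∀ t : T, p * t = 0 ↔ (κ : T) ∣ t) :
    LiftsToDiffOp π Φ ↔ ∃ (k : ℕ) (h : MvPolynomial σ T),
      h * taylor q f - (∏ i, X i) ^ k * diagExpansion q (pDerivation p (polyDiff f)) ∈
        boxIdeal σ T (p + k) ⊔ Ideal.span {C (κ : T)} := by
  rw [liftsToDiffOp_iff_exists_coeff hq hf hm hker hπ hΦ]
  have hpos := (Fact.out : p.Prime).pos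
  have hpow : ∀ k, (∏ i, X i) ^ k * taylor q f ^ p + C (p : T) *
      ((∏ i, X i) ^ k * diagExpansion q (pDerivation p (polyDiff f))) ∈ boxIdeal σ T (p + k) := by
    intro k
    rw [mul_left_comm, ← mul_add]
    exact prod_X_pow_mul_mem_boxIdeal (taylor_pow_add_mem hf)
  have hpred : taylor q f ^ p = taylor q f ^ (p - 1) * taylor q f := by
    rw [← pow_succ, Nat.sub_add_cancel hpos]
  refine exists_congr fun k => ⟨?_, ?_⟩
  · rintro ⟨g, hgf, hgp⟩
    obtain ⟨j, hj, r, hr, hjr⟩ := Submodule.mem_sup.mp hgp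
    obtain ⟨h, rfl⟩ := Ideal.mem_span_singleton.mp hr
    refine ⟨h, ?_⟩
    have hpk : p + k = (p - 1 + k) + 1 := by omega
    -- Replacing `g` by `g - j` turns the condition on `g` into one on `h`, up to a factor `p`.
    have key : C (p : T) * (h * taylor q f -
        (∏ i, X i) ^ k * diagExpansion q (pDerivation p (polyDiff f))) ∈ boxIdeal σ T (p + k) := by
      have e := sub_mem (sub_mem hgf (hpow k)) (Ideal.mul_mem_right (taylor q f) _ hj)
      rw [sub_eq_iff_eq_add.mp hjr.symm, hpred] at e
      convert e using 1
      ring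
    rw [hpk] at key ⊢
    -- Membership in `(z_i ^ (p + k))` is read off coefficients, where `p` can be cancelled.
    refine mem_boxIdeal_of_coeff_mem fun a ha => ?_
    rw [Ideal.mem_span_singleton, ← hκ, ← coeff_C_mul]
    exact mem_boxIdeal_iff.mp key a ha
  · rintro ⟨h, hh⟩
    obtain ⟨j, hj, r, hr, hjr⟩ := Submodule.mem_sup.mp hh
    obtain ⟨u, rfl⟩ := Ideal.mem_span_singleton.mp hr
    have h0 : C (p : T) * C (κ : T) = (0 : MvPolynomial σ T) := by
      rw [← C_mul, (hκ _).mpr dvd_rfl, map_zero]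
    refine ⟨(∏ i, X i) ^ k * taylor q f ^ (p - 1) + C (p : T) * h, ?_, ?_⟩
    · have e := add_mem (hpow k) (Ideal.mul_mem_left _ (C (p : T)) hj)
      convert e using 1
      rw [hpred]
      linear_combination (- C (p : T)) * hjr + u * h0
    · rw [add_sub_cancel_left]
      exact Ideal.mem_sup_right (Ideal.mul_mem_right _ _ (Ideal.mem_span_singleton_self _))

/-! ### Vanishing of the obstruction as a condition in `ℤ[x, y]` -/

/-- The ideal `(f(x), f(y), (y_i - x_i)^M, κ)` of `ℤ[x, y]`. With `κ = 0` it is the preimage of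
`((y_i - x_i)^M)` in `P_R`, and with `κ = p` that of `((y_i - x_i)^M, p)`. -/
def obstructionIdeal (f : MvPolynomial σ ℤ) (M κ : ℕ) : Ideal (PS σ) :=
  Ideal.span {rename Sum.inl f, rename Sum.inr f} ⊔
    Ideal.span (Set.range fun i : σ => (yVar i - xVar i) ^ M) ⊔ Ideal.span {(κ : PS σ)}

omit [Fintype σ] [DecidableEq σ] in
/-- The kernel of `ℤ[x, y] → T[z]` is generated by the kernel of `ℤ[x] → T`: modulo the latter,
`z_i ↦ y_i - x_i` defines an inverse. -/
theorem ker_diagExpansion_le (hq : Function.Surjective q) :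
    RingHom.ker (diagExpansion q) ≤
      (RingHom.ker q).map (rename (R := ℤ) (Sum.inl : σ → σ ⊕ σ)) := by
  intro s hs
  set I := (RingHom.ker q).map (rename (R := ℤ) (Sum.inl : σ → σ ⊕ σ)) with hI
  let θ₀ : MvPolynomial σ ℤ →+* PS σ ⧸ I :=
    (Ideal.Quotient.mk I).comp (RingHomClass.toRingHom (rename (Sum.inl : σ → σ ⊕ σ)))
  have hθ₀ : RingHom.ker q ≤ RingHom.ker θ₀ := fun t ht =>
    Ideal.Quotient.eq_zero_iff_mem.mpr (Ideal.mem_map_of_mem _ ht)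
  let θ : T →+* PS σ ⧸ I := RingHom.liftOfSurjective q hq ⟨θ₀, hθ₀⟩
  have hθ : ∀ t, θ (q t) = Ideal.Quotient.mk I (rename Sum.inl t) :=
    RingHom.liftOfRightInverse_comp_apply _ _ _ ⟨θ₀, hθ₀⟩
  let ψ : MvPolynomial σ T →+* PS σ ⧸ I :=
    eval₂Hom θ fun i => Ideal.Quotient.mk I (yVar i - xVar i)
  have hψ : ψ (diagExpansion q s) = Ideal.Quotient.mk I s := by
    refine DFunLike.congr_fun (f := ψ.comp (RingHomClass.toRingHom (diagExpansion q)))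
      (ringHom_ext' (RingHom.ext_int _ _) ?_) s
    rintro (i | i) <;> simp [ψ, diagExpansion, hθ]
  rw [← Ideal.Quotient.eq_zero_iff_mem, ← hψ, hs, map_zero]

omit [Fintype σ] [DecidableEq σ] in
theorem diagExpansion_surjective (hq : Function.Surjective q) :
    Function.Surjective (diagExpansion q) := by
  intro g
  induction g using MvPolynomial.induction_on with
  | C t =>
    obtain ⟨s, rfl⟩ := hq t
    exact ⟨_, diagExpansion_inl s⟩
  | add g h hg hh =>
    obtain ⟨s, rfl⟩ := hg
    obtain ⟨t, rfl⟩ := hh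
    exact ⟨s + t, map_add _ _ _⟩
  | mul_X g i hg =>
    obtain ⟨s, rfl⟩ := hg
    exact ⟨s * (yVar i - xVar i), by rw [map_mul, diagExpansion_sub]⟩

omit [DecidableEq σ] [Fintype σ] in
theorem mem_obstructionIdeal_iff_diagExpansion (hq : Function.Surjective q) (hf : q f = 0)
    {m κ M : ℕ} (hκm : κ ∣ m)
    (hker : ∀ s, q s = 0 → s ∈ Ideal.span {f, (m : MvPolynomial σ ℤ)}) (s : PS σ) :
    s ∈ obstructionIdeal f M κ ↔ ∃ h : MvPolynomial σ T,
      h * taylor q f - diagExpansion q s ∈ boxIdeal σ T M ⊔ Ideal.span {C (κ : T)} := by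
  have hmap : (obstructionIdeal f M κ).map (diagExpansion q) =
      Ideal.span {taylor q f} ⊔ (boxIdeal σ T M ⊔ Ideal.span {C (κ : T)}) := by
    rw [obstructionIdeal, Ideal.map_sup, Ideal.map_sup, Ideal.map_span, Ideal.map_span,
      Ideal.map_span, ← Set.range_comp, Set.image_singleton, Set.image_pair, diagExpansion_inl,
      diagExpansion_inr, hf, map_zero, Ideal.span_insert_zero, map_natCast, map_natCast, boxIdeal,
      sup_assoc]
    congr! 5 with i
    simp only [Function.comp_apply, map_pow, diagExpansion_sub]
  have hle : RingHom.ker (diagExpansion q) ≤ obstructionIdeal f M κ := by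
    refine (ker_diagExpansion_le hq).trans (Ideal.map_le_iff_le_comap.mpr fun t ht => ?_)
    refine (Ideal.span_le.mpr ?_ : Ideal.span {f, (m : MvPolynomial σ ℤ)} ≤ _) (hker t ht)
    rintro _ (rfl | rfl)
    · exact Ideal.mem_sup_left (Ideal.mem_sup_left (Ideal.subset_span (Set.mem_insert _ _)))
    · refine Ideal.mem_sup_right (Ideal.mem_span_singleton.mpr ?_)
      rw [map_natCast]
      exact Nat.cast_dvd_cast hκm
  have hiff : s ∈ obstructionIdeal f M κ ↔
      diagExpansion q s ∈ (obstructionIdeal f M κ).map (diagExpansion q) := by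
    rw [← Ideal.mem_comap, Ideal.comap_map_of_surjective _ (diagExpansion_surjective hq),
      ← RingHom.ker_eq_comap_bot, sup_eq_left.mpr hle]
  rw [hiff, hmap, Submodule.mem_sup]
  constructor
  · rintro ⟨a, ha, b, hb, hab⟩
    obtain ⟨h, rfl⟩ := Ideal.mem_span_singleton'.mp ha
    refine ⟨h, ?_⟩
    rw [← hab, sub_add_cancel_left]
    exact neg_mem hb
  · rintro ⟨h, hh⟩
    exact ⟨_, Ideal.mem_span_singleton'.mpr ⟨h, rfl⟩, _, neg_mem hh, by ring⟩

/-- The Frobenius trace lifts to `T` if and only if the obstruction vanishes, modulo `κ`, in terms of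
ideals of `ℤ[x, y]`. -/
theorem liftsToDiffOp_iff_mem_obstructionIdeal (hq : Function.Surjective q) (hf : q f = 0) {m : ℕ}
    (hm : (m : T) = 0) (hker : ∀ s, q s = 0 → s ∈ Ideal.span {f, (m : MvPolynomial σ ℤ)})
    (hπ : ∀ t, π t = 0 ↔ (p : T) ∣ t)
    (hΦ : ∀ s, Φ (π (q s)) = π (q (polyTrace p σ ℤ (f ^ (p - 1) * s))))
    {κ : ℕ} (hκ : ∀ t : T, p * t = 0 ↔ (κ : T) ∣ t) (hκm : κ ∣ m) :
    LiftsToDiffOp π Φ ↔ ∃ k : ℕ, (∏ i, (yVar i - xVar i)) ^ k * pDerivation p (polyDiff f) ∈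
      obstructionIdeal f (p + k) κ := by
  rw [liftsToDiffOp_iff_exists_mul hq hf hm hker hπ hΦ hκ]
  refine exists_congr fun k => ?_
  rw [mem_obstructionIdeal_iff_diagExpansion hq hf hκm hker, map_mul, map_pow, map_prod]
  simp_rw [diagExpansion_sub]

end Criterion

end

/-! ### The enveloping algebra of the hypersurface, and the two reductions -/

section Enveloping

variable {σ : Type*} (f : MvPolynomial σ ℤ)

theorem toPR_inl (s : MvPolynomial σ ℤ) :
    toPR f (rename Sum.inl s) =
      (Ideal.Quotient.mk (Ideal.span {f}) s) ⊗ₜ[ℤ] (1 : Hypersurface f) := by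
  refine DFunLike.congr_fun (f := (RingHomClass.toRingHom (toPR f)).comp
    (RingHomClass.toRingHom (rename (R := ℤ) Sum.inl)))
    (g := (Algebra.TensorProduct.includeLeft : Hypersurface f →ₐ[ℤ] PR f).toRingHom.comp
      (Ideal.Quotient.mk (Ideal.span {f}))) (ringHom_ext' (RingHom.ext_int _ _) fun i => ?_) s
  simp [toPR]

theorem toPR_inr (s : MvPolynomial σ ℤ) :
    toPR f (rename Sum.inr s) =
      (1 : Hypersurface f) ⊗ₜ[ℤ] (Ideal.Quotient.mk (Ideal.span {f}) s) := by
  refine DFunLike.congr_fun (f := (RingHomClass.toRingHom (toPR f)).comp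
    (RingHomClass.toRingHom (rename (R := ℤ) Sum.inr)))
    (g := (Algebra.TensorProduct.includeRight : Hypersurface f →ₐ[ℤ] PR f).toRingHom.comp
      (Ideal.Quotient.mk (Ideal.span {f}))) (ringHom_ext' (RingHom.ext_int _ _) fun i => ?_) s
  simp [toPR]

theorem toPR_surjective : Function.Surjective (toPR f) := by
  intro t
  induction t using TensorProduct.induction_on with
  | zero => exact ⟨0, map_zero _⟩
  | tmul a b =>
    obtain ⟨a, rfl⟩ := Ideal.Quotient.mk_surjective a
    obtain ⟨b, rfl⟩ := Ideal.Quotient.mk_surjective b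
    exact ⟨rename Sum.inl a * rename Sum.inr b, by
      rw [map_mul, toPR_inl, toPR_inr, Algebra.TensorProduct.tmul_mul_tmul, one_mul, mul_one]⟩
  | add a b ha hb =>
    obtain ⟨s, rfl⟩ := ha
    obtain ⟨t, rfl⟩ := hb
    exact ⟨s + t, map_add _ _ _⟩

theorem ker_toPR_le :
    RingHom.ker (toPR f) ≤ Ideal.span {rename Sum.inl f, rename Sum.inr f} := by
  intro s hs
  set I : Ideal (PS σ) := Ideal.span {rename Sum.inl f, rename Sum.inr f}
  let θ (j : σ → σ ⊕ σ) (hj : rename j f ∈ I) : Hypersurface f →ₐ[ℤ] PS σ ⧸ I :=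
    (Ideal.quotientMap I (rename (R := ℤ) j).toRingHom (by
      rw [Ideal.span_singleton_le_iff_mem]; exact hj)).toIntAlgHom
  let ψ : PR f →ₐ[ℤ] PS σ ⧸ I := Algebra.TensorProduct.lift
    (θ Sum.inl (Ideal.subset_span (by simp))) (θ Sum.inr (Ideal.subset_span (by simp)))
    fun _ _ => Commute.all _ _
  have hψ : ψ (toPR f s) = Ideal.Quotient.mk I s := by
    refine DFunLike.congr_fun
      (f := (RingHomClass.toRingHom ψ).comp (RingHomClass.toRingHom (toPR f)))
      (ringHom_ext' (RingHom.ext_int _ _) ?_) s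
    rintro (i | i)
    · change ψ (toPR f (X (Sum.inl i))) = _
      rw [← rename_X (R := ℤ) Sum.inl i, toPR_inl]
      refine (Algebra.TensorProduct.lift_tmul _ _ _ _ _).trans ?_
      rw [map_one, mul_one]
      rfl
    · change ψ (toPR f (X (Sum.inr i))) = _
      rw [← rename_X (R := ℤ) Sum.inr i, toPR_inr]
      refine (Algebra.TensorProduct.lift_tmul _ _ _ _ _).trans ?_
      rw [map_one, one_mul]
      rfl
  rw [← Ideal.Quotient.eq_zero_iff_mem, ← hψ, hs, map_zero]

theorem mem_obstructionIdeal_iff_toPR (s : PS σ) (M κ : ℕ) :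
    s ∈ obstructionIdeal f M κ ↔
      toPR f s ∈ Ideal.span (Set.range fun i => diagGen f i ^ M) ⊔ Ideal.span {(κ : PR f)} := by
  have hf0 : Ideal.Quotient.mk (Ideal.span {f}) f = 0 :=
    Ideal.Quotient.eq_zero_iff_mem.mpr (Ideal.mem_span_singleton_self f)
  have hmap : (obstructionIdeal f M κ).map (toPR f) =
      Ideal.span (Set.range fun i => diagGen f i ^ M) ⊔ Ideal.span {(κ : PR f)} := by
    rw [obstructionIdeal, Ideal.map_sup, Ideal.map_sup, Ideal.map_span, Ideal.map_span,
      Ideal.map_span, ← Set.range_comp, Set.image_singleton, Set.image_pair, toPR_inl, toPR_inr, hf0,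
      TensorProduct.zero_tmul, TensorProduct.tmul_zero, Set.pair_eq_singleton,
      Ideal.span_singleton_zero, bot_sup_eq, map_natCast]
    congr! 4 with i
    simp only [Function.comp_apply, map_pow, diagGen]
  have hle : RingHom.ker (toPR f) ≤ obstructionIdeal f M κ :=
    (ker_toPR_le f).trans (le_sup_left.trans le_sup_left)
  rw [← hmap, ← Ideal.mem_comap, Ideal.comap_map_of_surjective _ (toPR_surjective f),
    ← RingHom.ker_eq_comap_bot, sup_eq_left.mpr hle]

variable [Fintype σ] [DecidableEq σ] (p : ℕ) [Fact p.Prime]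

theorem obstruction_eq_zero_iff :
    obstruction f p = 0 ↔ ∃ k : ℕ, (∏ i, (yVar i - xVar i)) ^ k * pDerivation p (polyDiff f) ∈
      obstructionIdeal f (p + k) 0 := by
  rw [obstruction, cechClass_eq_zero_iff]
  refine exists_congr fun k => ?_
  rw [mem_obstructionIdeal_iff_toPR, Nat.cast_zero, Ideal.span_singleton_zero, sup_bot_eq,
    smul_eq_mul, smul_eq_mul, Ideal.mul_top, map_mul, map_pow, map_prod]
  rfl

theorem reductionMap_obstruction_eq_zero_iff :
    reductionMap f p (obstruction f p) = 0 ↔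
      ∃ k : ℕ, (∏ i, (yVar i - xVar i)) ^ k * pDerivation p (polyDiff f) ∈
        obstructionIdeal f (p + k) p := by
  have h : reductionMap f p (obstruction f p) = cechClass (diagGen f)
      (Submodule.mkQ (Ideal.span {(p : PR f)}) (toPR f (pDerivation p (polyDiff f)))) p := by
    change Submodule.Quotient.mk _ = Submodule.Quotient.mk _
    rw [IsLocalizedModule.map_LocalizedModules]
  rw [h, cechClass_eq_zero_iff]
  refine exists_congr fun k => ?_
  rw [mem_obstructionIdeal_iff_toPR, map_mul, map_pow, map_prod, ← map_smul,
    ← Submodule.mem_comap, ← Submodule.range_mkQ, ← Submodule.map_top, ← Submodule.map_smul'',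
    Submodule.comap_map_mkQ, smul_eq_mul, smul_eq_mul, Ideal.mul_top, sup_comm]
  rfl

omit [Fintype σ] [DecidableEq σ] [Fact p.Prime] in
/-- `R → P_R`, `t ↦ t ⊗ 1`, is split injective, so `p` is a nonzerodivisor on `R` as well. -/
theorem eq_zero_of_natCast_mul_eq_zero (hp : IsRegular (p : PR f)) {t : Hypersurface f}
    (h : p * t = 0) : t = 0 := by
  have h1 : (p : PR f) * t ⊗ₜ[ℤ] 1 = 0 := by
    rw [← map_natCast (Algebra.TensorProduct.includeLeft : Hypersurface f →ₐ[ℤ] PR f) p,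
      Algebra.TensorProduct.includeLeft_apply, Algebra.TensorProduct.tmul_mul_tmul, h,
      TensorProduct.zero_tmul]
  have h2 := congrArg (Algebra.TensorProduct.lmul' ℤ) (hp.left.mul_left_eq_zero_iff.mp h1)
  rwa [Algebra.TensorProduct.lmul'_apply_tmul, mul_one, map_zero] at h2

variable {f p}

omit [DecidableEq σ] in
theorem map_dividedPartial (a : σ →₀ ℕ) (s : MvPolynomial σ ℤ) {A : Type*} [CommRing A] :
    map (Int.castRingHom A) (dividedPartial ℤ a s) =
      dividedPartial A a (map (Int.castRingHom A) s) := by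
  induction s using MvPolynomial.induction_on' with
  | monomial b c => simp [dividedPartial_monomial]
  | add s t hs ht => simp only [map_add, hs, ht]

omit [DecidableEq σ] in
theorem frobeniusTraceModP_mk (s : MvPolynomial σ ℤ) :
    frobeniusTraceModP f p (toModInt f p (Ideal.Quotient.mk _ s)) =
      toModInt f p (Ideal.Quotient.mk _ (polyTrace p σ ℤ (f ^ (p - 1) * s))) := by
  have h : ∀ t, modPEquiv f p (toModInt f p (Ideal.Quotient.mk _ t)) =
      Ideal.Quotient.mk _ (map (Int.castRingHom (ZMod p)) t) := fun t => rfl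
  change (modPEquiv f p).symm
    (frobeniusTrace p _ (modPEquiv f p (toModInt f p (Ideal.Quotient.mk _ s)))) = _
  rw [RingEquiv.symm_apply_eq, h, h, frobeniusTrace_mk, polyTrace, polyTrace, map_dividedPartial,
    map_mul (map _), map_pow (map _)]

omit [Fintype σ] [DecidableEq σ] [Fact p.Prime] in
theorem toModInt_eq_zero_iff (m : ℕ) (t : Hypersurface f) :
    toModInt f m t = 0 ↔ (m : Hypersurface f) ∣ t := by
  rw [Ideal.Quotient.eq_zero_iff_mem, Ideal.mem_span_singleton]

theorem liftsToDiffOp_toModInt_iff (hp : IsRegular (p : PR f)) :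
    LiftsToDiffOp (toModInt f p) (frobeniusTraceModP f p) ↔ obstruction f p = 0 := by
  rw [obstruction_eq_zero_iff]
  refine liftsToDiffOp_iff_mem_obstructionIdeal (m := 0) (q := Ideal.Quotient.mk (Ideal.span {f}))
    (π := toModInt f p) (Φ := frobeniusTraceModP f p) Ideal.Quotient.mk_surjective
    (Ideal.Quotient.eq_zero_iff_mem.mpr (Ideal.mem_span_singleton_self f)) Nat.cast_zero
    (fun s hs => ?_) (toModInt_eq_zero_iff p) ?_ (fun t => ?_) dvd_rfl
  · rw [Ideal.Quotient.eq_zero_iff_mem] at hs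
    exact Ideal.span_mono (by simp) hs
  · intro s
    exact frobeniusTraceModP_mk s
  · rw [Nat.cast_zero, zero_dvd_iff]
    exact ⟨eq_zero_of_natCast_mul_eq_zero f p hp, fun h => by rw [h, mul_zero]⟩

/-- The criterion for `T = R/p²R`, where `R = ℤ[x]/(f)`. The annihilator of `p` in `T` is `pT`,
because `p` is a nonzerodivisor on `R`. -/
theorem liftsToDiffOp_iff_of_ker_sq (hp : IsRegular (p : PR f)) {T R' : Type*} [CommRing T]
    [CommRing R'] {ρ : Hypersurface f →+* T} (hρ : Function.Surjective ρ)
    (hker : ∀ t, ρ t = 0 ↔ ((p ^ 2 : ℕ) : Hypersurface f) ∣ t) {π : T →+* R'}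
    (hπ : ∀ t, π (ρ t) = 0 ↔ (p : Hypersurface f) ∣ t) {Φ : AddEnd R'}
    (hΦ : ∀ s, Φ (π (ρ (Ideal.Quotient.mk _ s))) =
      π (ρ (Ideal.Quotient.mk _ (polyTrace p σ ℤ (f ^ (p - 1) * s))))) :
    LiftsToDiffOp π Φ ↔ reductionMap f p (obstruction f p) = 0 := by
  rw [reductionMap_obstruction_eq_zero_iff]
  have hp2 : ((p ^ 2 : ℕ) : T) = 0 := by
    rw [← map_natCast ρ, hker]
  have hdvd : ∀ t, (p : T) ∣ ρ t ↔ (p : Hypersurface f) ∣ t := by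
    refine fun t => ⟨?_, fun h => by simpa using map_dvd ρ h⟩
    rintro ⟨u, hu⟩
    obtain ⟨u, rfl⟩ := hρ u
    rw [← map_natCast ρ, ← map_mul, ← sub_eq_zero, ← map_sub, hker, Nat.cast_pow] at hu
    exact (dvd_sub_left (dvd_mul_right _ u)).mp ((dvd_pow_self _ two_ne_zero).trans hu)
  refine liftsToDiffOp_iff_mem_obstructionIdeal (m := p ^ 2) (q := ρ.comp (Ideal.Quotient.mk _))
    (hρ.comp Ideal.Quotient.mk_surjective) ?_ hp2 (fun s hs => ?_) (fun t => ?_) hΦ (fun t => ?_)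
    (dvd_pow_self p two_ne_zero)
  · rw [RingHom.comp_apply, Ideal.Quotient.eq_zero_iff_mem.mpr (Ideal.mem_span_singleton_self f),
      map_zero]
  · obtain ⟨a, ha⟩ := (hker _).mp hs
    obtain ⟨a, rfl⟩ := Ideal.Quotient.mk_surjective a
    rw [← map_natCast (Ideal.Quotient.mk _), ← map_mul, Ideal.Quotient.eq,
      Ideal.mem_span_singleton'] at ha
    obtain ⟨b, hb⟩ := ha
    exact Ideal.mem_span_pair.mpr ⟨b, a, by rw [hb, mul_comm a, sub_add_cancel]⟩
  · obtain ⟨t, rfl⟩ := hρ t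
    rw [hπ, hdvd]
  · obtain ⟨t, rfl⟩ := hρ t
    rw [hdvd, ← map_natCast ρ, ← map_mul, hker]
    constructor
    · rintro ⟨u, hu⟩
      refine ⟨u, sub_eq_zero.mp (eq_zero_of_natCast_mul_eq_zero f p hp ?_)⟩
      rw [mul_sub, hu]
      push_cast
      ring
    · rintro ⟨u, rfl⟩
      exact ⟨u, by push_cast; ring⟩

theorem liftsToDiffOp_modSqToMod_iff (hp : IsRegular (p : PR f)) :
    LiftsToDiffOp (R := ModInt f (p ^ 2)) (modSqToMod f p) (frobeniusTraceModP f p) ↔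
      reductionMap f p (obstruction f p) = 0 := by
  refine liftsToDiffOp_iff_of_ker_sq (T := ModInt f (p ^ 2)) hp (ρ := toModInt f (p ^ 2))
    Ideal.Quotient.mk_surjective (toModInt_eq_zero_iff _) (fun t => toModInt_eq_zero_iff p t)
    fun s => ?_
  exact frobeniusTraceModP_mk s

end Enveloping

end FrobTrace

theorem theorem3 (d : ℕ) (f : MvPolynomial (Fin (d + 1)) ℤ) (hf : f ≠ 0)
    (n : ℕ) (hhom : f.IsHomogeneous n) (p : ℕ) [Fact p.Prime]
    (hp : IsRegular (p : FrobTrace.PR f)) :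
    (FrobTrace.LiftsToDiffOp (FrobTrace.toModInt f p) (FrobTrace.frobeniusTraceModP f p) ↔
        FrobTrace.obstruction f p = 0) ∧
      (FrobTrace.LiftsToDiffOp (R := FrobTrace.ModInt f (p ^ 2)) (FrobTrace.modSqToMod f p) (FrobTrace.frobeniusTraceModP f p) ↔
        FrobTrace.reductionMap f p (FrobTrace.obstruction f p) = 0) :=
  ⟨FrobTrace.liftsToDiffOp_toModInt_iff hp, FrobTrace.liftsToDiffOp_modSqToMod_iff hp⟩
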